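/- Let $1\le r\le\omega$ and let $M$ be an $n$-dimensional $C^r$ manifold (Hausdorff, second countable, without boundary). A subset $L\subset M$ is called a leaf if it carries a $C^r$ differential structure $\sigma$ such that (1) $(L,\sigma)$ is a connected immersed submanifold of $M$ (of some dimension $k$), and (2) for every locally connected topological space $N$, every continuous map $f:N\to M$ with $f(N)\subset L$ is continuous as a map $N\to(L,\sigma)$. A $C^r$ foliation with singularities $F$ of $M$ is a partition of $M$ into leaves (possibly of different dimensions) such that for each $x\in M$, with $k$ the dimension of the leaf through $x$, there is a $C^r$ chart $(\psi,U)$ around $x$ with $\psi(U)=V_1\times V_2$, where $V_1\subset\mathbb R^k$ and $V_2\subset\mathbb R^{n-k}$ are open neighbourhoods of the origins, $\psi(x)=(0,0)$, and for each leaf $L$ with $L\cap U\neq\emptyset$ one has $L\cap U=\psi^{-1}(V_1\times l)$, where $l=\{v\in V_2:\psi^{-1}(0,v)\in L\}$. A leaf $L$ is called proper if its own manifold topology coincides with the topology induced from $M$. The limit set $\Omega(L)$ is the set of all $y\in M$ for which there is a sequence of points of $L$ that converges to $y$ in $M$ but does not converge to $y$ in the leaf topology of $L$. For leaves $L_1,L_2$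 write $L_1\le L_2$ if $L_1\subset\Omega(L_2)$, and $L_1<L_2$ if $L_1\le L_2$ and $L_1\ne L_2$. The depth of a leaf $L$ (in the sense of Nishimori) is $$d(L)=\sup\{k:\text{ there exist leaves } L_1,\dots,L_k \text{ with } L_1<L_2<\dots<L_k=L\}\in\mathbb N\cup\{\infty\}.$$ Theorem (Narmanov). Let $F$ be a $C^r$ foliation with singularities of $M$ and let $L$ be a leaf of $F$. If $d(L)<\infty$, then $L$ is a proper leaf. -/

import Mathlib

open scoped Manifold ContDiff Topology

universe u

/-- The points of a subset `L` of `M`, regarded as a bare set: unlike the coercion of `L` to a type,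
this type does not carry the topology induced from `M`, so that `L` can be given its own
leaf topology. -/
def LeafSpace {M : Type u} (L : Set M) : Type u := {x : M // x ∈ L}

/-- The canonical injection of a leaf into the ambient manifold. -/
def LeafSpace.incl {M : Type u} {L : Set M} (x : LeafSpace L) : M := x.1

/-- A differential structure of class `C^r` on the subset `L` of the `n`-dimensional manifold `M`
which makes `L` a leaf: with it, `L` is a connected immersed submanifold of `M`, of dimension `dim`,
and every continuous map from a locally connected space into `M` with values in `L` is continuous
as a map into `L`. -/
structure LeafStructure (n : ℕ) (r : WithTop ℕ∞) (M : Type u) [TopologicalSpace M]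
    [ChartedSpace (EuclideanSpace ℝ (Fin n)) M] (L : Set M) where
  /-- the dimension of the leaf -/
  dim : ℕ
  /-- the leaf topology -/
  top : TopologicalSpace (LeafSpace L)
  /-- the atlas of the leaf -/
  charted : ChartedSpace (EuclideanSpace ℝ (Fin dim)) (LeafSpace L)
  isManifold : IsManifold (𝓡 dim) r (LeafSpace L)
  connected : ConnectedSpace (LeafSpace L)
  isImmersion : Manifold.IsImmersion (𝓡 dim) (𝓡 n) r (LeafSpace.incl : LeafSpace L → M)
  continuous_of_locallyConnected : ∀ (N : Type u) [TopologicalSpace N] [LocallyConnectedSpace N]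
    (f : N → LeafSpace L), Continuous (fun y => (f y).incl) → Continuous f

/-- A foliation with singularities, of class `C^r`, of the `n`-dimensional manifold `M`: a partition
of `M` into leaves, whose dimensions may vary, with adapted charts around all points. -/
structure SingularFoliation (n : ℕ) (r : WithTop ℕ∞) (M : Type u) [TopologicalSpace M]
    [ChartedSpace (EuclideanSpace ℝ (Fin n)) M] where
  /-- the leaves -/
  leaves : Set (Set M)
  isPartition : Setoid.IsPartition leaves
  /-- the structure of an immersed submanifold on each leaf -/
  str : ∀ L : leaves, LeafStructure n r M (L : Set M)
  /-- Around every point `x` there is a `C^r` chart `ψ` of `M` with `ψ x = (0, 0)` and with image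
  `V₁ × V₂`, where `V₁ ⊆ ℝ^k`, `V₂ ⊆ ℝ^(n-k)`, and `k` is the dimension of the leaf through `x`,
  such that every leaf that meets the domain of `ψ` is there of the form `ψ ⁻¹ (V₁ × l)` with
  `l = {v ∈ V₂ | ψ ⁻¹ (0, v) ∈ L}`. -/
  exists_chart : ∀ (L₀ : leaves) (x : M), x ∈ (L₀ : Set M) →
    ∃ (ψ : OpenPartialHomeomorph M
        (EuclideanSpace ℝ (Fin (str L₀).dim) × EuclideanSpace ℝ (Fin (n - (str L₀).dim))))
      (V₁ : Set (EuclideanSpace ℝ (Fin (str L₀).dim)))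
      (V₂ : Set (EuclideanSpace ℝ (Fin (n - (str L₀).dim)))),
      ContMDiffOn (𝓡 n)
        𝓘(ℝ, EuclideanSpace ℝ (Fin (str L₀).dim) × EuclideanSpace ℝ (Fin (n - (str L₀).dim)))
        r ψ ψ.source ∧
      ContMDiffOn
        𝓘(ℝ, EuclideanSpace ℝ (Fin (str L₀).dim) × EuclideanSpace ℝ (Fin (n - (str L₀).dim)))
        (𝓡 n) r ψ.symm ψ.target ∧
      x ∈ ψ.source ∧ ψ x = (0, 0) ∧ IsOpen V₁ ∧ IsOpen V₂ ∧ ψ.target = V₁ ×ˢ V₂ ∧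
      ∀ L ∈ leaves, (L ∩ ψ.source).Nonempty →
        L ∩ ψ.source = ψ.source ∩ ψ ⁻¹' (V₁ ×ˢ {v | v ∈ V₂ ∧ ψ.symm (0, v) ∈ L})

namespace SingularFoliation

variable {n : ℕ} {r : WithTop ℕ∞} {M : Type u} [TopologicalSpace M]
  [ChartedSpace (EuclideanSpace ℝ (Fin n)) M]

/-- The type of leaves, that is, the leaf space `M/F`. -/
abbrev Leaf (F : SingularFoliation n r M) : Type u := F.leaves

/-- A leaf is proper if its own topology coincides with the topology induced from `M`. -/
def IsProperLeaf (F : SingularFoliation n r M) (L : F.Leaf) : Prop :=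
  (F.str L).top = TopologicalSpace.induced LeafSpace.incl inferInstance

/-- The limit set `Ω(L)`: the points `y` of `M` for which there is a sequence of points of `L`
that converges to `y` in `M` and does not converge to `y` in the leaf topology of `L`. -/
def limitSet (F : SingularFoliation n r M) (L : F.Leaf) : Set M :=
  {y | ∃ s : ℕ → LeafSpace (L : Set M),
    Filter.Tendsto (fun m => (s m).incl) Filter.atTop (𝓝 y) ∧
    ¬ ∃ z : LeafSpace (L : Set M), z.incl = y ∧
      Filter.Tendsto s Filter.atTop (@nhds _ (F.str L).top z)}

/-- Nishimori's relation `L₁ ≤ L₂`: `L₁` is contained in the limit set of `L₂`. -/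
def LeafLE (F : SingularFoliation n r M) (L₁ L₂ : F.Leaf) : Prop :=
  (L₁ : Set M) ⊆ F.limitSet L₂

/-- `L₁ < L₂`: `L₁ ≤ L₂` and `L₁ ≠ L₂`. -/
def LeafLT (F : SingularFoliation n r M) (L₁ L₂ : F.Leaf) : Prop :=
  F.LeafLE L₁ L₂ ∧ L₁ ≠ L₂

/-- The depth of a leaf: the supremum, in `ℕ ∪ {∞}`, of the numbers `k` such that there are
leaves `L₁ < L₂ < ⋯ < L_k = L`. -/
noncomputable def depth (F : SingularFoliation n r M) (L : F.Leaf) : ℕ∞ :=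
  sSup {d : ℕ∞ | ∃ c : List F.Leaf,
    c.IsChain F.LeafLT ∧ c.getLast? = some L ∧ d = (c.length : ℕ∞)}

end SingularFoliation

/-! The contrapositive is proved: a leaf `L` that is not proper has infinite depth.

Locally, `L` is a union of plaques of a distinguished chart, and these are open in the leaf
topology. So `L` is proper at a point exactly when the plaque through that point is isolated among
the plaques of `L`. This condition is constant along plaques, hence along the connected leaf: if it
fails once, it fails everywhere.

Then Baire's theorem is applied to `closure L` (`exists_ne_leaf_of_not_isProperLeaf`). `L` is a
countable union of compact pieces of plaques (`exists_countable_compact_cover`), each now nowhere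
dense in `closure L`. Saturations of open sets are open, and those of basic sets meeting `L` are
dense in `closure L`. A point outside all the pieces and inside all these saturations lies on a leaf
`K ≠ L` with `K` and `L` in each other's closure. Thus `L < K < L < ⋯`, and chains ending at `L`
have every length (`depth_eq_top`). -/

open Set Filter

/-! ### Slices of charts and the leaf topology. -/

/-- A continuous lift `g`, through an immersion of a `k`-manifold, of a slice `b ↦ ψ⁻¹ (b, v)` of a
`C^1` product chart with `k`-dimensional slices is a local homeomorphism. -/
theorem map_nhds_of_immersion_lift {n k : ℕ} {r : WithTop ℕ∞} (hr : 1 ≤ r)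
    {M : Type*} [TopologicalSpace M] [ChartedSpace (EuclideanSpace ℝ (Fin n)) M]
    [IsManifold (𝓡 n) r M]
    {X : Type*} [TopologicalSpace X] [ChartedSpace (EuclideanSpace ℝ (Fin k)) X]
    {E₂ : Type*} [NormedAddCommGroup E₂] [NormedSpace ℝ E₂]
    {i : X → M} {ψ : OpenPartialHomeomorph M (EuclideanSpace ℝ (Fin k) × E₂)}
    (hψ : ContMDiffOn (𝓡 n) 𝓘(ℝ, EuclideanSpace ℝ (Fin k) × E₂) r ψ ψ.source)
    (hψ' : ContMDiffOn 𝓘(ℝ, EuclideanSpace ℝ (Fin k) × E₂) (𝓡 n) r ψ.symm ψ.target)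
    {g : EuclideanSpace ℝ (Fin k) → X} {a : EuclideanSpace ℝ (Fin k)} {v : E₂}
    (hav : (a, v) ∈ ψ.target) (hi : Manifold.IsImmersionAt (𝓡 k) (𝓡 n) r i (g a))
    (hg : ContinuousAt g a) (hgi : ∀ᶠ b in 𝓝 a, i (g b) = ψ.symm (b, v)) :
    map g (𝓝 a) = 𝓝 (g a) := by
  refine le_antisymm hg ?_
  have hr0 : r ≠ 0 := by rintro rfl; simp at hr
  obtain ⟨F, _, _, hF⟩ := hi
  obtain ⟨dc, cc, hxd, hxc, -, hcc, -, e, he⟩ := hF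
  have hga : i (g a) = ψ.symm (a, v) := hgi.self_of_nhds
  have hslice : ContDiff ℝ r (fun b : EuclideanSpace ℝ (Fin k) => (b, v)) := by fun_prop
  have h1 : ContMDiffAt 𝓘(ℝ, EuclideanSpace ℝ (Fin k)) (𝓡 n) r (fun b => ψ.symm (b, v)) a := by
    have := (hψ'.contMDiffAt (ψ.open_target.mem_nhds hav))
    exact this.comp a hslice.contMDiff.contMDiffAt
  have hmem : ψ.symm (a, v) ∈ cc.source := hga ▸ hxc
  have h2 : ContMDiffAt 𝓘(ℝ, EuclideanSpace ℝ (Fin k)) (𝓡 n) r (fun b => cc (ψ.symm (b, v))) a :=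
    ((contMDiffOn_of_mem_maximalAtlas hcc).contMDiffAt (cc.open_source.mem_nhds hmem)).comp a h1
  -- In the immersion coordinates, `i` is `y ↦ (y, 0)`. `H` is the slice read in them, and `G`
  -- returns to the slice parameter.
  let H : EuclideanSpace ℝ (Fin k) → EuclideanSpace ℝ (Fin k) × F :=
    fun b => e.symm (cc (ψ.symm (b, v)))
  have hH : ContDiffAt ℝ r H a := e.symm.contDiff.contDiffAt.comp a h2.contDiffAt
  let G : EuclideanSpace ℝ (Fin k) × F → EuclideanSpace ℝ (Fin k) :=
    fun y => (ψ (cc.symm (e y))).1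
  have heH : e (H a) = cc (ψ.symm (a, v)) := by simp [H]
  have hG : ContDiffAt ℝ r G (H a) := by
    have h3 : ContMDiffAt (𝓡 n) (𝓡 n) r cc.symm (e (H a)) := by
      refine (contMDiffOn_symm_of_mem_maximalAtlas hcc).contMDiffAt (cc.open_target.mem_nhds ?_)
      rw [heH]; exact cc.map_source hmem
    have h4 : ContMDiffAt (𝓡 n) 𝓘(ℝ, EuclideanSpace ℝ (Fin k) × E₂) r ψ
        (cc.symm (e (H a))) := by
      refine hψ.contMDiffAt (ψ.open_source.mem_nhds ?_)
      rw [heH, cc.left_inv hmem]; exact ψ.map_target hav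
    have h5 : ContMDiffAt 𝓘(ℝ, EuclideanSpace ℝ (Fin k) × F)
        𝓘(ℝ, EuclideanSpace ℝ (Fin k) × E₂) r (fun y => ψ (cc.symm (e y))) (H a) :=
      h4.comp (H a) (h3.comp (H a) e.contDiff.contMDiff.contMDiffAt)
    exact contDiff_fst.contDiffAt.comp (H a) h5.contDiffAt
  have hψc : ∀ᶠ b in 𝓝 a, ψ.symm (b, v) ∈ cc.source :=
    h1.continuousAt.preimage_mem_nhds (cc.open_source.mem_nhds hmem)
  have htar : ∀ᶠ b in 𝓝 a, (b, v) ∈ ψ.target :=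
    hslice.continuous.continuousAt.preimage_mem_nhds (ψ.open_target.mem_nhds hav)
  have hGH : G ∘ H =ᶠ[𝓝 a] id := by
    filter_upwards [hψc, htar] with b hb hb'
    simp [G, H, cc.left_inv hb, ψ.right_inv hb']
  have hgd : ∀ᶠ b in 𝓝 a, g b ∈ dc.source :=
    hg.preimage_mem_nhds (dc.open_source.mem_nhds hxd)
  have hHg : ∀ᶠ b in 𝓝 a, H b = (dc (g b), 0) := by
    filter_upwards [hgd, hgi] with b hb hb'
    have := he (x := dc (g b)) (by simpa using dc.map_source hb)
    simp only [Function.comp, OpenPartialHomeomorph.extend_coe,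
      OpenPartialHomeomorph.extend_coe_symm, modelWithCornersSelf_coe,
      modelWithCornersSelf_coe_symm, id, dc.left_inv hb, hb'] at this
    simp [H, this]
  have hH' := hH.hasStrictFDerivAt hr0
  have hG' := (hG.hasStrictFDerivAt hr0).hasFDerivAt
  have hcomp := (hG'.comp a hH'.hasFDerivAt).unique ((hasFDerivAt_id a).congr_of_eventuallyEq hGH)
  have hsnd : (ContinuousLinearMap.snd ℝ _ F).comp (fderiv ℝ H a) = 0 := by
    refine (hasFDerivAt_snd.comp a hH'.hasFDerivAt).unique
      ((hasFDerivAt_const (0 : F) a).congr_of_eventuallyEq ?_)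
    filter_upwards [hHg] with b hb
    simp [hb]
  -- `G ∘ H = id` makes the derivative of `H` injective, and its second component is zero, so the
  -- first component is injective. Both dimensions being `k`, it is invertible and the inverse
  -- function theorem applies.
  have hinj : Function.Injective
      ((ContinuousLinearMap.fst ℝ (EuclideanSpace ℝ (Fin k)) F).comp (fderiv ℝ H a)) := by
    refine (injective_iff_map_eq_zero _).2 fun x hx => ?_
    have h0 : fderiv ℝ H a x = 0 := Prod.ext hx (DFunLike.congr_fun hsnd x)
    have := DFunLike.congr_fun hcomp x
    simpa [h0] using this.symm
  let A := (LinearEquiv.ofInjectiveEndo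
    ((ContinuousLinearMap.fst ℝ (EuclideanSpace ℝ (Fin k)) F).comp
      (fderiv ℝ H a)).toLinearMap hinj).toContinuousLinearEquiv
  have hh : HasStrictFDerivAt (fun b => (H b).1)
      (A : EuclideanSpace ℝ (Fin k) →L[ℝ] EuclideanSpace ℝ (Fin k)) a := by
    have hA : (A : EuclideanSpace ℝ (Fin k) →L[ℝ] EuclideanSpace ℝ (Fin k)) =
        (ContinuousLinearMap.fst ℝ (EuclideanSpace ℝ (Fin k)) F).comp (fderiv ℝ H a) :=
      ContinuousLinearMap.ext fun _ => rfl
    rw [hA]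
    exact hasStrictFDerivAt_fst.comp a hH'
  have hmap := hh.map_nhds_eq_of_equiv
  have hmap' : map (dc ∘ g) (𝓝 a) = 𝓝 (dc (g a)) := by
    rw [← show (H a).1 = dc (g a) by rw [hHg.self_of_nhds], ← hmap]
    exact map_congr (hHg.mono fun b hb => by simp [hb])
  have hx : map (dc.symm ∘ (dc ∘ g)) (𝓝 a) = 𝓝 (g a) := by
    rw [← map_map, hmap', dc.symm_map_nhds_eq hxd]
  rw [← hx]
  exact (map_congr (hgd.mono fun b hb => by simp [dc.left_inv hb])).le

/-- A slice of a `C^1` product chart that is contained in the leaf `L`, and has the dimension of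
`L`, is locally homeomorphic to `L`. -/
theorem LeafStructure.exists_lift {n : ℕ} {r : WithTop ℕ∞} (hr : 1 ≤ r)
    {M : Type u} [TopologicalSpace M] [ChartedSpace (EuclideanSpace ℝ (Fin n)) M]
    [IsManifold (𝓡 n) r M] {L : Set M} (S : LeafStructure n r M L)
    {E₂ : Type*} [NormedAddCommGroup E₂] [NormedSpace ℝ E₂]
    {ψ : OpenPartialHomeomorph M (EuclideanSpace ℝ (Fin S.dim) × E₂)}
    {V₁ : Set (EuclideanSpace ℝ (Fin S.dim))} {V₂ : Set E₂}
    (hψ : ContMDiffOn (𝓡 n) 𝓘(ℝ, EuclideanSpace ℝ (Fin S.dim) × E₂) r ψ ψ.source)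
    (hψ' : ContMDiffOn 𝓘(ℝ, EuclideanSpace ℝ (Fin S.dim) × E₂) (𝓡 n) r ψ.symm ψ.target)
    (hV₁ : IsOpen V₁) (htar : ψ.target = V₁ ×ˢ V₂) {v : E₂} (hv : v ∈ V₂)
    (hL : ∀ a ∈ V₁, ψ.symm (a, v) ∈ L) (hne : V₁.Nonempty) :
    ∃ g : EuclideanSpace ℝ (Fin S.dim) → LeafSpace L, (∀ a ∈ V₁, (g a).incl = ψ.symm (a, v)) ∧
      ∀ a ∈ V₁, map g (𝓝 a) = @nhds _ S.top (g a) := by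
  let := S.top
  let := S.charted
  obtain ⟨a₀, ha₀⟩ := hne
  classical
  let g : EuclideanSpace ℝ (Fin S.dim) → LeafSpace L :=
    fun a => if h : a ∈ V₁ then ⟨ψ.symm (a, v), hL a h⟩ else ⟨ψ.symm (a₀, v), hL a₀ ha₀⟩
  have hg : ∀ a ∈ V₁, (g a).incl = ψ.symm (a, v) := fun a ha => by
    simp [g, ha, LeafSpace.incl]
  -- An open subset of a Euclidean space is locally connected, so condition (2) on leaves applies;
  -- `ULift` moves it into the universe of `M`.
  have hcont : ContinuousOn g V₁ := by
    have hop : Topology.IsOpenEmbedding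
        (fun x : ULift.{u} V₁ => (x.down : EuclideanSpace ℝ (Fin S.dim))) :=
      hV₁.isOpenEmbedding_subtypeVal.comp Homeomorph.ulift.isOpenEmbedding
    have : LocallyConnectedSpace (ULift.{u} V₁) := hop.locallyConnectedSpace
    have h1 : Continuous fun x : ULift.{u} V₁ => g x.down := by
      refine S.continuous_of_locallyConnected _ _ ?_
      have h2 : Continuous fun x : ULift.{u} V₁ => ψ.symm ((x.down : EuclideanSpace ℝ _), v) := by
        refine ψ.continuousOn_symm.comp_continuous (by fun_prop) fun x => ?_
        rw [htar]
        exact ⟨x.down.2, hv⟩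
      exact h2.congr fun x => (hg _ x.down.2).symm
    rw [continuousOn_iff_continuous_domRestrict]
    exact h1.comp (continuous_uliftUp (X := V₁))
  refine ⟨g, hg, fun a ha => ?_⟩
  refine map_nhds_of_immersion_lift hr hψ hψ' (a := a) (v := v) (by rw [htar]; exact ⟨ha, hv⟩)
    (S.isImmersion.isImmersionAt _) (hcont.continuousAt (hV₁.mem_nhds ha)) ?_
  filter_upwards [hV₁.mem_nhds ha] with b hb using hg b hb

/-! ### Distinguished charts. -/

namespace SingularFoliation

variable {n : ℕ} {r : WithTop ℕ∞} {M : Type u} [TopologicalSpace M]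
  [ChartedSpace (EuclideanSpace ℝ (Fin n)) M]

theorem continuous_incl (F : SingularFoliation n r M) (L : F.Leaf) :
    @Continuous _ _ (F.str L).top _ (LeafSpace.incl : LeafSpace (L : Set M) → M) := by
  let := (F.str L).top
  let := (F.str L).charted
  have := (F.str L).isManifold
  exact continuous_iff_continuousAt.2 fun x =>
    ((F.str L).isImmersion.isImmersionAt x).continuousAt

/-- `ψ` is a distinguished chart for the leaf `L`, with image `V₁ × V₂`: the dimension of `V₁` is
that of `L`, each leaf is a union of slices `ψ ⁻¹ (V₁ × {v})`, and each slice which is contained in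
`L` is locally homeomorphic to `L`. -/
structure IsBox (F : SingularFoliation n r M) (L : F.Leaf)
    (ψ : OpenPartialHomeomorph M
      (EuclideanSpace ℝ (Fin (F.str L).dim) × EuclideanSpace ℝ (Fin (n - (F.str L).dim))))
    (V₁ : Set (EuclideanSpace ℝ (Fin (F.str L).dim)))
    (V₂ : Set (EuclideanSpace ℝ (Fin (n - (F.str L).dim)))) : Prop where
  isOpen₁ : IsOpen V₁
  isOpen₂ : IsOpen V₂
  zero_mem : (0 : EuclideanSpace ℝ (Fin (F.str L).dim)) ∈ V₁
  target_eq : ψ.target = V₁ ×ˢ V₂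
  mem_iff : ∀ K : F.Leaf, ∀ a ∈ V₁, ∀ b ∈ V₁, ∀ v ∈ V₂,
    ψ.symm (a, v) ∈ (K : Set M) ↔ ψ.symm (b, v) ∈ (K : Set M)
  exists_lift : ∀ v ∈ V₂, ψ.symm (0, v) ∈ (L : Set M) →
    ∃ g : EuclideanSpace ℝ (Fin (F.str L).dim) → LeafSpace (L : Set M),
      (∀ a ∈ V₁, (g a).incl = ψ.symm (a, v)) ∧
      ∀ a ∈ V₁, map g (𝓝 a) = @nhds _ (F.str L).top (g a)

theorem exists_isBox [IsManifold (𝓡 n) r M] (hr : 1 ≤ r) (F : SingularFoliation n r M)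
    (L : F.Leaf) {x : M} (hx : x ∈ (L : Set M)) :
    ∃ ψ V₁ V₂, F.IsBox L ψ V₁ V₂ ∧ x ∈ ψ.source ∧ ψ x = (0, 0) := by
  obtain ⟨ψ, V₁, V₂, hψ, hψ', hxs, hx0, hV₁, hV₂, htar, hsat⟩ := F.exists_chart L x hx
  have h0 : (0 : EuclideanSpace ℝ (Fin (F.str L).dim)) ∈ V₁ := by
    have := ψ.map_source hxs
    rw [hx0, htar] at this
    exact this.1
  have key : ∀ K : F.Leaf, ∀ a ∈ V₁, ∀ b ∈ V₁, ∀ v ∈ V₂,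
      ψ.symm (a, v) ∈ (K : Set M) → ψ.symm (b, v) ∈ (K : Set M) := by
    intro K a ha b hb v hv h
    have hta : (a, v) ∈ ψ.target := by rw [htar]; exact ⟨ha, hv⟩
    have htb : (b, v) ∈ ψ.target := by rw [htar]; exact ⟨hb, hv⟩
    have hK := hsat K K.2 ⟨_, h, ψ.map_target hta⟩
    have h1 : ψ.symm (a, v) ∈ (K : Set M) ∩ ψ.source := ⟨h, ψ.map_target hta⟩
    rw [hK, mem_inter_iff, mem_preimage, ψ.right_inv hta] at h1
    have h2 : ψ.symm (b, v) ∈ (K : Set M) ∩ ψ.source := by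
      rw [hK, mem_inter_iff, mem_preimage, ψ.right_inv htb]
      exact ⟨ψ.map_target htb, hb, h1.2.2⟩
    exact h2.1
  refine ⟨ψ, V₁, V₂, ⟨hV₁, hV₂, h0, htar, fun K a ha b hb v hv =>
    ⟨key K a ha b hb v hv, key K b hb a ha v hv⟩, fun v hv h => ?_⟩, hxs, hx0⟩
  exact (F.str L).exists_lift hr hψ hψ' hV₁ htar hv (fun a ha => key L 0 h0 a ha v hv h) ⟨0, h0⟩

end SingularFoliation

/-! ### Countable covers of connected spaces. -/

theorem LeafSpace.incl_injective {M : Type u} {L : Set M} :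
    Function.Injective (LeafSpace.incl : LeafSpace L → M) := Subtype.val_injective

/-- In a connected space, a cover by nonempty open sets each of which meets only countably many
of the others is countable. -/
theorem countable_of_isOpen_cover_of_connected {X ι : Type*} [TopologicalSpace X]
    [ConnectedSpace X] {P : ι → Set X} (ho : ∀ i, IsOpen (P i)) (hne : ∀ i, (P i).Nonempty)
    (hcov : ⋃ i, P i = univ) (hc : ∀ i, {j | (P i ∩ P j).Nonempty}.Countable) : Countable ι := by
  obtain ⟨x₀⟩ := (inferInstance : Nonempty X)
  obtain ⟨i₀, hi₀⟩ := mem_iUnion.1 (hcov ▸ mem_univ x₀ : x₀ ∈ ⋃ i, P i)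
  -- Indices reached from `i₀` in `m` steps between intersecting members. The union of the members
  -- reached is clopen, since its complement is the union of the others.
  let A : ℕ → Set ι := fun m =>
    Nat.rec {i₀} (fun _ s => ⋃ i ∈ s, {j | (P i ∩ P j).Nonempty}) m
  have hA : ∀ m, (A m).Countable := by
    intro m
    induction m with
    | zero => exact countable_singleton i₀
    | succ m ih => exact ih.biUnion fun i _ => hc i
  have hstep : ∀ m, ∀ i ∈ A m, ∀ j, (P i ∩ P j).Nonempty → j ∈ A (m + 1) :=
    fun m i hi j hj => mem_biUnion hi hj
  let U : Set X := ⋃ i ∈ ⋃ m, A m, P i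
  have hU : IsOpen U := isOpen_biUnion fun i _ => ho i
  have hUc : Uᶜ = ⋃ i ∈ (⋃ m, A m)ᶜ, P i := by
    ext y
    constructor
    · intro hy
      obtain ⟨i, hi⟩ := mem_iUnion.1 (hcov ▸ mem_univ y : y ∈ ⋃ i, P i)
      exact mem_biUnion (fun h => hy (mem_biUnion h hi)) hi
    · intro hy hyU
      obtain ⟨j, hj, hyj⟩ := mem_iUnion₂.1 hy
      obtain ⟨i, hi, hyi⟩ := mem_iUnion₂.1 hyU
      obtain ⟨m, hm⟩ := mem_iUnion.1 hi
      exact hj (mem_iUnion.2 ⟨m + 1, hstep m i hm j ⟨y, hyi, hyj⟩⟩)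
  have hcl : IsClopen U := ⟨⟨hUc ▸ isOpen_biUnion fun i _ => ho i⟩, hU⟩
  have huniv : U = univ :=
    hcl.eq_univ ⟨x₀, mem_biUnion (mem_iUnion.2 ⟨0, mem_singleton i₀⟩) hi₀⟩
  have hall : (⋃ m, A m) = univ := by
    refine eq_univ_of_forall fun j => ?_
    obtain ⟨y, hy⟩ := hne j
    obtain ⟨i, hi, hyi⟩ := mem_iUnion₂.1 (huniv ▸ mem_univ y : y ∈ U)
    obtain ⟨m, hm⟩ := mem_iUnion.1 hi
    exact mem_iUnion.2 ⟨m + 1, hstep m i hm j ⟨y, hyi, hy⟩⟩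
  exact countable_univ_iff.1 (hall ▸ countable_iUnion hA)

/-! ### Plaques and properness. -/

namespace SingularFoliation

variable {n : ℕ} {r : WithTop ℕ∞} {M : Type u} [TopologicalSpace M]
  [ChartedSpace (EuclideanSpace ℝ (Fin n)) M]

theorem exists_leaf (F : SingularFoliation n r M) (x : M) : ∃ L : F.Leaf, x ∈ (L : Set M) := by
  obtain ⟨K, ⟨hK, hx⟩, -⟩ := F.isPartition.2 x
  exact ⟨⟨K, hK⟩, hx⟩

theorem leaf_eq (F : SingularFoliation n r M) {L K : F.Leaf} {x : M} (hL : x ∈ (L : Set M))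
    (hK : x ∈ (K : Set M)) : L = K :=
  Subtype.ext ((F.isPartition.2 x).unique ⟨L.2, hL⟩ ⟨K.2, hK⟩)

/-- The slice over `v` of a product chart, as a subset of the leaf `L`. -/
def plaque {E₁ E₂ : Type*} [TopologicalSpace E₁] [TopologicalSpace E₂] (L : Set M)
    (ψ : OpenPartialHomeomorph M (E₁ × E₂)) (V₁ : Set E₁) (v : E₂) : Set (LeafSpace L) :=
  {y | ∃ a ∈ V₁, y.incl = ψ.symm (a, v)}

namespace IsBox

variable {F : SingularFoliation n r M} {L : F.Leaf}
  {ψ : OpenPartialHomeomorph M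
      (EuclideanSpace ℝ (Fin (F.str L).dim) × EuclideanSpace ℝ (Fin (n - (F.str L).dim)))}
  {V₁ : Set (EuclideanSpace ℝ (Fin (F.str L).dim))}
  {V₂ : Set (EuclideanSpace ℝ (Fin (n - (F.str L).dim)))}
  (h : F.IsBox L ψ V₁ V₂) {a b : EuclideanSpace ℝ (Fin (F.str L).dim)}
  {v w : EuclideanSpace ℝ (Fin (n - (F.str L).dim))}

include h

theorem mem_target (ha : a ∈ V₁) (hv : v ∈ V₂) : (a, v) ∈ ψ.target := by
  rw [h.target_eq]; exact ⟨ha, hv⟩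

theorem inj (ha : a ∈ V₁) (hb : b ∈ V₁) (hv : v ∈ V₂) (hw : w ∈ V₂)
    (he : ψ.symm (a, v) = ψ.symm (b, w)) : a = b ∧ v = w :=
  Prod.ext_iff.1 (ψ.symm.injOn (h.mem_target ha hv) (h.mem_target hb hw) he)

theorem exists_eq {y : M} (hy : y ∈ ψ.source) :
    ∃ a ∈ V₁, ∃ v ∈ V₂, ψ.symm (a, v) = y ∧ ψ y = (a, v) := by
  have := ψ.map_source hy
  rw [h.target_eq] at this
  exact ⟨_, this.1, _, this.2, ψ.left_inv hy, rfl⟩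

theorem isOpen_plaque (hv : v ∈ V₂) :
    IsOpen[(F.str L).top] (plaque (L : Set M) ψ V₁ v) := by
  let := (F.str L).top
  refine isOpen_iff_mem_nhds.2 ?_
  rintro y ⟨a, ha, hy⟩
  have h0 : ψ.symm (0, v) ∈ (L : Set M) :=
    (h.mem_iff L a ha 0 h.zero_mem v hv).1 (hy ▸ y.2)
  obtain ⟨g, hg, hmap⟩ := h.exists_lift v hv h0
  have hya : g a = y := LeafSpace.incl_injective ((hg a ha).trans hy.symm)
  rw [← hya, ← hmap a ha]
  filter_upwards [image_mem_map (h.isOpen₁.mem_nhds ha)]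
  rintro _ ⟨b, hb, rfl⟩
  exact ⟨b, hb, hg b hb⟩

/-- If `L` is near one of its points contained in a single plaque, then this plaque is isolated
among those of `L`. -/
theorem eventually_eq_of_nhds (ha : a ∈ V₁) (hv : v ∈ V₂) {O : Set M}
    (hO : O ∈ 𝓝 (ψ.symm (a, v)))
    (hsub : ∀ y ∈ O, y ∈ (L : Set M) → ∃ b ∈ V₁, y = ψ.symm (b, v)) :
    ∀ᶠ w in 𝓝 v, ψ.symm (0, w) ∈ (L : Set M) → w = v := by
  have hc : ContinuousAt (fun w => ψ.symm (a, w)) v :=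
    (ψ.continuousAt_symm (h.mem_target ha hv)).comp (by fun_prop : ContinuousAt (fun w => (a, w)) v)
  filter_upwards [hc.preimage_mem_nhds hO, h.isOpen₂.mem_nhds hv] with w hw hw2 hwL
  obtain ⟨b, hb, hab⟩ := hsub _ hw ((h.mem_iff L 0 h.zero_mem a ha w hw2).1 hwL)
  exact (h.inj ha hb hw2 hv hab).2

/-- The right-hand side does not involve `a`, which is why properness at a point spreads along the
plaque. -/
theorem comap_nhds_le_iff (ha : a ∈ V₁) (hv : v ∈ V₂) {z : LeafSpace (L : Set M)}
    (hz : z.incl = ψ.symm (a, v)) :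
    comap LeafSpace.incl (𝓝 z.incl) ≤ @nhds _ (F.str L).top z ↔
      ∀ᶠ w in 𝓝 v, ψ.symm (0, w) ∈ (L : Set M) → w = v := by
  let := (F.str L).top
  constructor
  · intro hle
    have hmem := hle ((h.isOpen_plaque hv).mem_nhds ⟨a, ha, hz⟩)
    obtain ⟨O, hO, hsub⟩ := mem_comap.1 hmem
    exact h.eventually_eq_of_nhds ha hv (hz ▸ hO) fun y hy hyL => hsub (a := ⟨y, hyL⟩) hy
  · intro hev N hN
    have h0 : ψ.symm (0, v) ∈ (L : Set M) :=
      (h.mem_iff L a ha 0 h.zero_mem v hv).1 (hz ▸ z.2)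
    obtain ⟨g, hg, hmap⟩ := h.exists_lift v hv h0
    have hza : g a = z := LeafSpace.incl_injective ((hg a ha).trans hz.symm)
    rw [← hza, ← hmap a ha] at hN
    have hsrc : ψ.symm (a, v) ∈ ψ.source := ψ.map_target (h.mem_target ha hv)
    have hψz : ψ (ψ.symm (a, v)) = (a, v) := ψ.right_inv (h.mem_target ha hv)
    have hnear : ∀ᶠ y in 𝓝 z.incl, y ∈ ψ.source ∧ (ψ y).1 ∈ g ⁻¹' N ∧
        (ψ.symm (0, (ψ y).2) ∈ (L : Set M) → (ψ y).2 = v) := by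
      rw [hz]
      have hψt : Tendsto ψ (𝓝 (ψ.symm (a, v))) (𝓝 a ×ˢ 𝓝 v) := by
        have hcont := ψ.continuousAt hsrc
        rwa [ContinuousAt, hψz, nhds_prod_eq] at hcont
      exact Filter.Eventually.and (ψ.open_source.mem_nhds hsrc)
        (((tendsto_fst.comp hψt).eventually hN).and ((tendsto_snd.comp hψt).eventually hev))
    refine mem_comap.2 ⟨_, hnear, ?_⟩
    rintro y ⟨hys, hyN, hyv⟩
    obtain ⟨b, hb, w, hw, hbw, hψy⟩ := h.exists_eq hys
    rw [hψy] at hyN hyv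
    obtain rfl : w = v :=
      hyv ((h.mem_iff L b hb 0 h.zero_mem w hw).1 (hbw ▸ y.2))
    have : g b = y := LeafSpace.incl_injective ((hg b hb).trans hbw)
    exact this ▸ hyN

end IsBox

theorem isProperLeaf_iff (F : SingularFoliation n r M) (L : F.Leaf) :
    F.IsProperLeaf L ↔ ∀ z : LeafSpace (L : Set M),
      comap LeafSpace.incl (𝓝 z.incl) ≤ @nhds _ (F.str L).top z := by
  have hle := (F.continuous_incl L).le_induced
  constructor
  · intro hp z
    rw [IsProperLeaf] at hp
    rw [hp, nhds_induced]
  · intro hz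
    refine le_antisymm hle ?_
    rw [le_iff_nhds]
    intro z
    rw [nhds_induced]
    exact hz z

/-! ### Saturations and closures of leaves. -/

variable [IsManifold (𝓡 n) r M]

/-- A property of points which is constant along the plaques of a leaf is constant on the leaf. -/
theorem leaf_induction (hr : 1 ≤ r) (F : SingularFoliation n r M) (L : F.Leaf) {Q : M → Prop}
    (hQ : ∀ ψ V₁ V₂, F.IsBox L ψ V₁ V₂ → ∀ a ∈ V₁, ∀ b ∈ V₁, ∀ v ∈ V₂,
      ψ.symm (a, v) ∈ (L : Set M) → Q (ψ.symm (a, v)) → Q (ψ.symm (b, v)))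
    {x y : M} (hx : x ∈ (L : Set M)) (hy : y ∈ (L : Set M)) (hQx : Q x) : Q y := by
  let := (F.str L).top
  have := (F.str L).connected
  have hloc : IsLocallyConstant fun z : LeafSpace (L : Set M) => Q z.incl := by
    refine (IsLocallyConstant.iff_eventually_eq _).2 fun z => ?_
    obtain ⟨ψ, V₁, V₂, h, hzs, hz0⟩ := F.exists_isBox hr L z.2
    obtain ⟨a, ha, v, hv, hav, -⟩ := h.exists_eq hzs
    filter_upwards [(h.isOpen_plaque hv).mem_nhds ⟨a, ha, hav.symm⟩]
    rintro y ⟨b, hb, hyb⟩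
    have hza : z.incl = ψ.symm (a, v) := hav.symm
    rw [hza, hyb]
    exact propext ⟨hQ ψ V₁ V₂ h b hb a ha v hv (hyb ▸ y.2),
      hQ ψ V₁ V₂ h a ha b hb v hv (hza ▸ z.2)⟩
  have := hloc.apply_eq_of_preconnectedSpace ⟨x, hx⟩ ⟨y, hy⟩
  exact cast this hQx

/-- The union of the leaves that meet a set. -/
def saturation (F : SingularFoliation n r M) (O : Set M) : Set M :=
  {y | ∃ K : F.Leaf, y ∈ (K : Set M) ∧ ((K : Set M) ∩ O).Nonempty}

omit [IsManifold (𝓡 n) r M] in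
theorem mem_saturation_of_mem_leaf (F : SingularFoliation n r M) {O : Set M} {K : F.Leaf} {x y : M}
    (hx : x ∈ (K : Set M)) (hy : y ∈ (K : Set M)) (h : x ∈ F.saturation O) :
    y ∈ F.saturation O := by
  obtain ⟨K', hxK', hne⟩ := h
  obtain rfl := F.leaf_eq hx hxK'
  exact ⟨K, hy, hne⟩

/-- Being interior to the saturation spreads along plaques: a point near `ψ.symm (b, v)` slides
within its own slice to a point near `ψ.symm (a, v)` on the same leaf. -/
theorem isOpen_saturation (hr : 1 ≤ r) (F : SingularFoliation n r M) {O : Set M} (hO : IsOpen O) :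
    IsOpen (F.saturation O) := by
  refine isOpen_iff_mem_nhds.2 ?_
  rintro y ⟨K, hyK, x, hxK, hxO⟩
  have hsub : O ⊆ F.saturation O := fun z hz =>
    let ⟨K', hK'⟩ := F.exists_leaf z
    ⟨K', hK', z, hK', hz⟩
  refine F.leaf_induction hr K (Q := fun y => F.saturation O ∈ 𝓝 y) ?_ hxK hyK
    (mem_of_superset (hO.mem_nhds hxO) hsub)
  intro ψ V₁ V₂ h a ha b hb v hv _ hS
  have hc : ContinuousAt (fun w => ψ.symm (a, w)) v :=
    (ψ.continuousAt_symm (h.mem_target ha hv)).comp (by fun_prop : ContinuousAt (fun w => (a, w)) v)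
  have hsrc : ψ.symm (b, v) ∈ ψ.source := ψ.map_target (h.mem_target hb hv)
  have hψt : Tendsto (fun y => (ψ y).2) (𝓝 (ψ.symm (b, v))) (𝓝 v) := by
    have h1 : ψ (ψ.symm (b, v)) = (b, v) := ψ.right_inv (h.mem_target hb hv)
    have h2 := (ψ.continuousAt hsrc).snd
    rwa [ContinuousAt, h1] at h2
  filter_upwards [ψ.open_source.mem_nhds hsrc, hψt (hc.preimage_mem_nhds hS)] with z hz hz2
  obtain ⟨c, hc, w, hw, hcw, hψz⟩ := h.exists_eq hz
  rw [mem_preimage, hψz] at hz2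
  obtain ⟨K', hK', hne⟩ := hz2
  exact ⟨K', hcw ▸ (h.mem_iff K' a ha c hc w hw).1 hK', hne⟩

/-- The closure of a leaf is a union of leaves. -/
theorem leaf_subset_closure (hr : 1 ≤ r) (F : SingularFoliation n r M) (L : F.Leaf) {K : F.Leaf}
    {x : M} (hx : x ∈ (K : Set M)) (hxL : x ∈ closure (L : Set M)) :
    (K : Set M) ⊆ closure (L : Set M) := by
  by_contra hcon
  obtain ⟨y, hyK, hy⟩ := not_subset.1 hcon
  -- The saturation of the complement of `closure L` is an open set around `x`, so it meets `L`;
  -- then `L` itself would meet that complement.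
  obtain ⟨z, ⟨K', hzK', w, hwK', hw⟩, hzL⟩ := mem_closure_iff.1 hxL _
    (F.isOpen_saturation hr (isClosed_closure (s := (L : Set M))).isOpen_compl) ⟨K, hx, y, hyK, hy⟩
  obtain rfl := F.leaf_eq hzL hzK'
  exact hw (subset_closure hwK')

end SingularFoliation

/-! ### Countability of plaques and the Baire argument. -/

namespace SingularFoliation

variable {n : ℕ} {r : WithTop ℕ∞} {M : Type u} [TopologicalSpace M]
  [ChartedSpace (EuclideanSpace ℝ (Fin n)) M]

/-- An open plaque of one box meets only countably many plaques of another box. -/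
theorem IsBox.countable_plaques {F : SingularFoliation n r M} {L : F.Leaf}
    {ψ ψ' : OpenPartialHomeomorph M
      (EuclideanSpace ℝ (Fin (F.str L).dim) × EuclideanSpace ℝ (Fin (n - (F.str L).dim)))}
    {V₁ V₁' : Set (EuclideanSpace ℝ (Fin (F.str L).dim))}
    {V₂ V₂' : Set (EuclideanSpace ℝ (Fin (n - (F.str L).dim)))}
    (h : F.IsBox L ψ V₁ V₂) (h' : F.IsBox L ψ' V₁' V₂')
    {v : EuclideanSpace ℝ (Fin (n - (F.str L).dim))} (hv : v ∈ V₂)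
    (hvL : ψ.symm (0, v) ∈ (L : Set M)) :
    {w | w ∈ V₂' ∧
      (plaque (L : Set M) ψ V₁ v ∩ plaque (L : Set M) ψ' V₁' w).Nonempty}.Countable := by
  let := (F.str L).top
  obtain ⟨g, hg, hmap⟩ := h.exists_lift v hv hvL
  have hcont : ContinuousOn g V₁ := fun a ha =>
    ContinuousAt.continuousWithinAt (hmap a ha).le
  -- Pulled back by `g`, the plaques become disjoint nonempty open sets of a separable space.
  refine PairwiseDisjoint.countable_of_isOpen
    (s := fun w => V₁ ∩ g ⁻¹' plaque (L : Set M) ψ' V₁' w) ?_ ?_ ?_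
  · intro w hw w' hw' hne
    refine disjoint_left.2 ?_
    rintro a ⟨-, b, hb, hab⟩ ⟨-, b', hb', hab'⟩
    exact hne (h'.inj hb hb' hw.1 hw'.1 (hab.symm.trans hab')).2
  · exact fun w hw => hcont.isOpen_inter_preimage h.isOpen₁ (h'.isOpen_plaque hw.1)
  · rintro w ⟨-, y, ⟨a, ha, hya⟩, hy⟩
    have : g a = y := LeafSpace.incl_injective ((hg a ha).trans hya.symm)
    exact ⟨a, ha, by rwa [mem_preimage, this]⟩

variable [IsManifold (𝓡 n) r M] [SecondCountableTopology M]

/-- A leaf is covered by countably many compact subsets of plaques. -/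
theorem exists_countable_compact_cover (hr : 1 ≤ r) (F : SingularFoliation n r M) (L : F.Leaf) :
    ∃ 𝒦 : Set (Set M), 𝒦.Countable ∧ (L : Set M) ⊆ ⋃₀ 𝒦 ∧ ∀ K ∈ 𝒦, IsCompact K ∧
      ∃ ψ V₁ V₂, F.IsBox L ψ V₁ V₂ ∧ ∃ v ∈ V₂, ψ.symm (0, v) ∈ (L : Set M) ∧
        ∀ y ∈ K, ∃ a ∈ V₁, y = ψ.symm (a, v) := by
  let := (F.str L).top
  have := (F.str L).connected
  choose ψ V₁ V₂ hbox hsrc h0 using fun x : LeafSpace (L : Set M) => F.exists_isBox hr L x.2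
  obtain ⟨t, htL, htc, hcov⟩ := TopologicalSpace.countable_cover_nhdsWithin
    (s := (L : Set M)) (f := fun x => {y | ∃ h : x ∈ (L : Set M), y ∈ (ψ ⟨x, h⟩).source})
    (fun x hx => mem_nhdsWithin_of_mem_nhds <| mem_of_superset
      ((ψ ⟨x, hx⟩).open_source.mem_nhds (hsrc ⟨x, hx⟩)) fun y hy => ⟨hx, hy⟩)
  let p : t → LeafSpace (L : Set M) := fun x => ⟨x.1, htL x.2⟩
  -- All plaques of `L` in the countably many chosen boxes. Their number is countable because `L` is
  -- connected in its leaf topology.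
  let ι := Σ x : t, {v // v ∈ V₂ (p x) ∧ (ψ (p x)).symm (0, v) ∈ (L : Set M)}
  have htc' : Countable t := htc.to_subtype
  let P : ι → Set (LeafSpace (L : Set M)) :=
    fun i => plaque (L : Set M) (ψ (p i.1)) (V₁ (p i.1)) i.2.1
  have hι : Countable ι := by
    refine countable_of_isOpen_cover_of_connected (P := P)
      (fun i => (hbox (p i.1)).isOpen_plaque i.2.2.1) (fun i => ?_) ?_ fun i => ?_
    · exact ⟨⟨_, i.2.2.2⟩, 0, (hbox (p i.1)).zero_mem, rfl⟩
    · refine eq_univ_of_forall fun y => ?_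
      obtain ⟨x, hx, hxL, hy⟩ := mem_iUnion₂.1 (hcov y.2)
      obtain ⟨a, ha, v, hv, hav, -⟩ := (hbox (p ⟨x, hx⟩)).exists_eq hy
      exact mem_iUnion.2 ⟨⟨⟨x, hx⟩, v, hv, ((hbox (p ⟨x, hx⟩)).mem_iff L a ha 0
        (hbox (p ⟨x, hx⟩)).zero_mem v hv).1 (hav ▸ y.2)⟩, a, ha, hav.symm⟩
    · have hc : ∀ x : t, {v : {v // v ∈ V₂ (p x) ∧ (ψ (p x)).symm (0, v) ∈ (L : Set M)} |
          (P i ∩ P ⟨x, v⟩).Nonempty}.Countable := by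
        intro x
        refine Countable.mono (fun v hv => ?_)
          (((hbox (p i.1)).countable_plaques (hbox (p x)) i.2.2.1 i.2.2.2).preimage
            Subtype.val_injective)
        exact ⟨v.2.1, hv⟩
      refine (countable_iUnion fun x => (hc x).image fun v => (⟨x, v⟩ : ι)).mono ?_
      rintro ⟨x, v⟩ hv
      exact mem_iUnion.2 ⟨x, v, hv, rfl⟩
  have hlc : ∀ x, LocallyCompactSpace (V₁ x) := fun x => (hbox x).isOpen₁.locallyCompactSpace
  -- Plaques need not be closed in `M`, so each is exhausted by compact pieces.
  let 𝒦 : ι × ℕ → Set M := fun q =>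
    (fun a : V₁ (p q.1.1) => (ψ (p q.1.1)).symm (a.1, q.1.2.1)) '' compactCovering _ q.2
  refine ⟨range 𝒦, countable_range 𝒦, fun y hy => ?_, ?_⟩
  · obtain ⟨x, hx, hxL, hys⟩ := mem_iUnion₂.1 (hcov hy)
    obtain ⟨a, ha, v, hv, hav, -⟩ := (hbox (p ⟨x, hx⟩)).exists_eq hys
    obtain ⟨m, hm⟩ := exists_mem_compactCovering (⟨a, ha⟩ : V₁ (p ⟨x, hx⟩))
    refine ⟨_, ⟨⟨⟨⟨x, hx⟩, v, hv, ((hbox (p ⟨x, hx⟩)).mem_iff L a ha 0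
        (hbox (p ⟨x, hx⟩)).zero_mem v hv).1 (hav ▸ hy)⟩, m⟩, rfl⟩, ⟨a, ha⟩, hm, hav⟩
  · rintro _ ⟨⟨⟨x, v, hv, hvL⟩, m⟩, rfl⟩
    refine ⟨(isCompact_compactCovering _ m).image ?_, _, _, _, hbox (p x), v, hv, hvL, ?_⟩
    · exact (ψ (p x)).continuousOn_symm.comp_continuous (by fun_prop)
        fun a => (hbox (p x)).mem_target a.2 hv
    · rintro _ ⟨a, -, rfl⟩
      exact ⟨a, a.2, rfl⟩

/-- The closure of a leaf that is not proper contains another leaf which is dense in it. -/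
theorem exists_ne_leaf_of_not_isProperLeaf [T2Space M] (hr : 1 ≤ r)
    (F : SingularFoliation n r M) (L : F.Leaf) (hL : ¬ F.IsProperLeaf L) :
    ∃ K : F.Leaf, K ≠ L ∧ (K : Set M) ⊆ closure (L : Set M) ∧
      (L : Set M) ⊆ closure (K : Set M) := by
  let := (F.str L).top
  -- Properness at a single point would spread to the whole leaf.
  have hbad : ∀ z : LeafSpace (L : Set M), ¬ comap LeafSpace.incl (𝓝 z.incl) ≤ 𝓝 z := by
    rw [isProperLeaf_iff] at hL
    push Not at hL
    obtain ⟨z₀, hz₀⟩ := hL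
    intro z hz
    refine hz₀ ?_
    refine F.leaf_induction hr L (Q := fun x => ∀ z : LeafSpace (L : Set M), z.incl = x →
      comap LeafSpace.incl (𝓝 z.incl) ≤ 𝓝 z) ?_ z.2 z₀.2 ?_ z₀ rfl
    · intro ψ V₁ V₂ h a ha b hb v hv hL hQ z hz
      exact (h.comap_nhds_le_iff hb hv hz).2
        ((h.comap_nhds_le_iff (z := ⟨_, hL⟩) ha hv rfl).1 (hQ _ rfl))
    · intro z' hz'
      obtain rfl : z' = z := LeafSpace.incl_injective hz'
      exact hz
  have : LocallyCompactSpace M := ChartedSpace.locallyCompactSpace (EuclideanSpace ℝ (Fin n)) M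
  let Y := closure (L : Set M)
  have : LocallyCompactSpace Y := isClosed_closure.locallyCompactSpace
  obtain ⟨𝒦, h𝒦c, h𝒦L, h𝒦⟩ := F.exists_countable_compact_cover hr L
  let 𝒟 : Set (Set Y) := (fun K : Set M => (Subtype.val ⁻¹' Kᶜ : Set Y)) '' 𝒦 ∪
    (fun B : Set M => (Subtype.val ⁻¹' F.saturation B : Set Y)) ''
      {B ∈ TopologicalSpace.countableBasis M | ((L : Set M) ∩ B).Nonempty}
  have hdense : Dense (⋂₀ 𝒟) := by
    refine dense_sInter_of_isOpen ?_ ?_ ?_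
    · rintro _ (⟨K, hK, rfl⟩ | ⟨B, hB, rfl⟩)
      · exact (h𝒦 K hK).1.isClosed.isOpen_compl.preimage continuous_subtype_val
      · exact (F.isOpen_saturation hr (TopologicalSpace.isOpen_of_mem_countableBasis hB.1)).preimage
          continuous_subtype_val
    · exact (h𝒦c.image _).union
        (((TopologicalSpace.countable_countableBasis M).mono (sep_subset _ _)).image _)
    · rintro _ (⟨K, hK, rfl⟩ | ⟨B, hB, rfl⟩)
      · obtain ⟨-, ψ, V₁, V₂, h, v, hv, hvL, hKv⟩ := h𝒦 K hK
        change Dense (Subtype.val ⁻¹' K : Set Y)ᶜ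
        rw [← interior_eq_empty_iff_dense_compl, eq_empty_iff_forall_notMem]
        rintro y hy
        obtain ⟨a, ha, hya⟩ := hKv _ (interior_subset (s := (Subtype.val ⁻¹' K : Set Y)) hy)
        have hyL : ψ.symm (a, v) ∈ (L : Set M) := (h.mem_iff L 0 h.zero_mem a ha v hv).1 hvL
        rw [mem_interior_iff_mem_nhds, nhds_subtype, mem_comap] at hy
        obtain ⟨O, hO, hsub⟩ := hy
        -- An interior point of the piece in `closure L` would make its plaque isolated, hence `L`
        -- proper there.
        refine hbad ⟨_, hyL⟩ ((h.comap_nhds_le_iff (z := ⟨_, hyL⟩) ha hv rfl).2 ?_)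
        exact h.eventually_eq_of_nhds ha hv (hya ▸ hO) fun z hz hzL =>
          hKv z (hsub (a := ⟨z, subset_closure hzL⟩) hz)
      · intro y
        refine mem_closure_iff.2 fun O hO hyO => ?_
        obtain ⟨O', hO', rfl⟩ := isOpen_induced_iff.1 hO
        obtain ⟨z, hzO, hzL⟩ := mem_closure_iff.1 y.2 O' hO' hyO
        exact ⟨⟨z, subset_closure hzL⟩, hzO, L, hzL, hB.2⟩
  obtain ⟨x₀, hx₀⟩ : (L : Set M).Nonempty :=
    Setoid.nonempty_of_mem_partition F.isPartition L.2
  have : Nonempty Y := ⟨⟨x₀, subset_closure hx₀⟩⟩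
  obtain ⟨y, hy⟩ := hdense.nonempty
  obtain ⟨K, hyK⟩ := F.exists_leaf y.1
  refine ⟨K, ?_, F.leaf_subset_closure hr L hyK y.2, fun x hx => ?_⟩
  · rintro rfl
    obtain ⟨C, hC, hyC⟩ := h𝒦L hyK
    exact hy _ (.inl ⟨C, hC, rfl⟩) hyC
  · refine (TopologicalSpace.isBasis_countableBasis M).mem_closure_iff.2 fun B hB hxB => ?_
    obtain ⟨K', hyK', hne⟩ := hy _ (.inr ⟨B, ⟨hB, x, hx, hxB⟩, rfl⟩)
    obtain rfl := F.leaf_eq hyK hyK'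
    rwa [inter_comm]

/-! ### Nishimori's order and the depth. -/

-- Points of `L` lie off `K`, so a sequence in `K` converging to one in `M` has no such limit in the
-- leaf.
omit [IsManifold (𝓡 n) r M] in
theorem leafLT_of_subset_closure (F : SingularFoliation n r M) {L K : F.Leaf} (hne : L ≠ K)
    (hsub : (L : Set M) ⊆ closure (K : Set M)) : F.LeafLT L K := by
  refine ⟨fun y hy => ?_, hne⟩
  obtain ⟨s, hsK, hs⟩ := mem_closure_iff_seq_limit.1 (hsub hy)
  refine ⟨fun m => ⟨s m, hsK m⟩, hs, ?_⟩
  rintro ⟨z, hz, -⟩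
  exact hne (F.leaf_eq hy (hz ▸ z.2))

-- Chains may repeat leaves, so alternating `L` and `K` gives every length; the induction swaps the
-- two at each step.
omit [IsManifold (𝓡 n) r M] [SecondCountableTopology M] in
theorem depth_eq_top (F : SingularFoliation n r M) {L K : F.Leaf} (hLK : F.LeafLT L K)
    (hKL : F.LeafLT K L) : F.depth L = ⊤ := by
  have key : ∀ m : ℕ, ∀ L K : F.Leaf, F.LeafLT L K → F.LeafLT K L →
      ∃ c : List F.Leaf, c.IsChain F.LeafLT ∧ c.getLast? = some L ∧ c.length = m + 1 := by
    intro m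
    induction m with
    | zero => exact fun L K _ _ => ⟨[L], by simp, by simp, rfl⟩
    | succ m ih =>
      intro L K hLK hKL
      obtain ⟨c, hc, hlast, hlen⟩ := ih K L hKL hLK
      refine ⟨c ++ [L], List.isChain_append.2 ⟨hc, by simp, ?_⟩, by simp, by simp [hlen]⟩
      intro x hx y hy
      rw [hlast] at hx
      obtain rfl : K = x := by simpa using hx
      obtain rfl : L = y := by simpa using hy
      exact hKL
  refine ENat.eq_top_iff_forall_ge.2 fun m => ?_
  obtain ⟨c, hc, hlast, hlen⟩ := key m L K hLK hKL
  refine le_trans ?_ (le_sSup ⟨c, hc, hlast, rfl⟩)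
  rw [hlen]
  exact_mod_cast Nat.le_succ m

end SingularFoliation

theorem mainTheorem7 {n : ℕ} {r : WithTop ℕ∞} (hr : 1 ≤ r)
    {M : Type u} [TopologicalSpace M] [T2Space M] [SecondCountableTopology M]
    [ChartedSpace (EuclideanSpace ℝ (Fin n)) M] [IsManifold (𝓡 n) r M]
    (F : SingularFoliation n r M) (L : F.Leaf) (hL : F.depth L < ⊤) :
    F.IsProperLeaf L := by
  by_contra hcon
  obtain ⟨K, hne, hKL, hLK⟩ := F.exists_ne_leaf_of_not_isProperLeaf hr L hcon
  exact hL.ne (F.depth_eq_top (F.leafLT_of_subset_closure hne.symm hLK)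
    (F.leafLT_of_subset_closure hne hKL))
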